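/- Let $F$ be a field of characteristic $p>0$ and let $G$ be a group (possibly infinite) containing an element of order $p$, i.e. the group algebra $FG$ is modular. Let $V(FG)$ be the group of normalized units of $FG$, that is, of those units $\sum_{g\in G}\alpha_g g$ of $FG$ for which $\sum_{g\in G}\alpha_g=1$. Call a group locally nilpotent if each of its finitely generated subgroups is nilpotent. Then $V(FG)$ is locally nilpotent if and only if $G$ is locally nilpotent and the commutator subgroup $G'$ of $G$ is a $p$-group (every element of $G'$ has order a power of $p$; the trivial group is allowed). -/

import Mathlib

/-- The augmentation map of the group algebra `FG`: the `F`-algebra homomorphism to `F`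
that sends every group element to `1`, i.e. the sum of the coefficients. -/
noncomputable def groupAugmentation (F G : Type*) [Field F] [Group G] :
    MonoidAlgebra F G →ₐ[F] F :=
  MonoidAlgebra.lift F F G (1 : G →* F)

theorem groupAugmentation_eq_sum (F G : Type*) [Field F] [Group G] (x : MonoidAlgebra F G) :
    groupAugmentation F G x = x.coeff.sum fun _ a => a := by
  simp [groupAugmentation, MonoidAlgebra.lift_apply]

/-- The group `V(FG)` of normalized units of the group algebra `FG`: the units of
augmentation `1`. -/
noncomputable def normalizedUnits (F G : Type*) [Field F] [Group G] :
    Subgroup (MonoidAlgebra F G)ˣ :=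
  (Units.map (groupAugmentation F G : MonoidAlgebra F G →* F)).ker

theorem mem_normalizedUnits (F G : Type*) [Field F] [Group G] (u : (MonoidAlgebra F G)ˣ) :
    u ∈ normalizedUnits F G ↔ groupAugmentation F G (u : MonoidAlgebra F G) = 1 := by
  simp [normalizedUnits, MonoidHom.mem_ker, Units.ext_iff]

/-- A group is locally nilpotent if all its finitely generated subgroups are nilpotent. -/
def IsLocallyNilpotentGroup (G : Type*) [Group G] : Prop :=
  ∀ S : Subgroup G, S.FG → Group.IsNilpotent S

/-- The group algebra `FG` over a field of positive characteristic `p` is modular if `G`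
contains an element of order `p`. -/
def IsModularGroupAlgebra (F G : Type*) [Field F] [Group G] : Prop :=
  0 < ringChar F ∧ ∃ g : G, orderOf g = ringChar F

open scoped commutatorElement

/-! Necessity. `G` embeds in `V(FG)`, so it is locally nilpotent. A finitely generated subgroup `S`
containing an element of order `p` has a central `z` of order `p`. Put `e = 1 + z + ... + z^(p-1)`;
then `e² = 0`, and for `a, h` in `S` the commutators of `h` with units `1 + e x` iterate the
operator `D = conj_h - 1` on `a`. Nilpotency gives `e Dⁿ a = 0`, Frobenius turns `D^(p^n)` into
`conj_h^(p^n) - 1`, and a power `h^(p^k)` commutes with `a`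
(`IsLocallyNilpotentGroup.exists_pow_commute`). Hence `S/Z(S)` is a finite `p`-group, and by Schur
so is `S'`.

Sufficiency. Finitely many units and their inverses live in `FH` with `H` finitely generated
nilpotent and `H'` a finite `p`-group. Factoring out central elements of order `p` in `H'` shows
that the strong Lie series of `FH` reaches zero (`MonoidAlgebra.exists_strongLieSeries_eq_bot`),
which makes the unit group of `FH` nilpotent. -/

/-! ### Finiteness in finitely generated nilpotent groups. -/

theorem Subgroup.finite_commutatorSet_of_finiteIndex_center (G : Type*) [Group G]
    [(Subgroup.center G).FiniteIndex] : Finite (commutatorSet G) := by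
  have hfin : Finite (G ⧸ Subgroup.center G) := inferInstance
  refine Set.Finite.to_subtype ((Set.finite_range
    fun q : (G ⧸ Subgroup.center G) × (G ⧸ Subgroup.center G) => ⁅q.1.out, q.2.out⁆).subset ?_)
  rintro _ ⟨a, b, rfl⟩
  obtain ⟨c, hc⟩ := QuotientGroup.mk_out_eq_mul (Subgroup.center G) a
  obtain ⟨d, hd⟩ := QuotientGroup.mk_out_eq_mul (Subgroup.center G) b
  refine ⟨(a, b), ?_⟩
  have h1 := fun x => Subgroup.mem_center_iff.1 c.2 x
  have h2 := fun x => Subgroup.mem_center_iff.1 d.2 x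
  have hca : ∀ x y : G, ⁅x * (c : G), y⁆ = ⁅x, y⁆ := fun x y => by
    have : ((c : G) : G) * y * (c : G)⁻¹ = y := by rw [← h1]; group
    calc ⁅x * (c : G), y⁆ = x * ((c : G) * y * (c : G)⁻¹) * x⁻¹ * y⁻¹ := by
          rw [commutatorElement_def]; group
      _ = ⁅x, y⁆ := by rw [this, commutatorElement_def]
  have hdb : ∀ x y : G, ⁅x, y * (d : G)⁆ = ⁅x, y⁆ := fun x y => by
    have : ((d : G) : G) * x⁻¹ * (d : G)⁻¹ = x⁻¹ := by rw [← h2]; group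
    calc ⁅x, y * (d : G)⁆ = x * y * ((d : G) * x⁻¹ * (d : G)⁻¹) * y⁻¹ := by
          rw [commutatorElement_def]; group
      _ = ⁅x, y⁆ := by rw [this, commutatorElement_def]
  change ⁅(a : G ⧸ Subgroup.center G).out, (b : G ⧸ Subgroup.center G).out⁆ = _
  rw [hc, hd, hca, hdb]

/-- If all commutators of elements of `K` with `g` are central, `x ↦ ⁅x, g⁆` is a homomorphism
from `K` to the center. -/
def Subgroup.commutatorHomOfCentral {G : Type*} [Group G] (K : Subgroup G) (g : G)
    (hK : ∀ x ∈ K, ⁅x, g⁆ ∈ Subgroup.center G) : K →* Subgroup.center G where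
  toFun x := ⟨⁅(x : G), g⁆, hK x x.2⟩
  map_one' := by ext; simp
  map_mul' x y := by
    ext
    have h := Subgroup.mem_center_iff.1 (hK y y.2) x
    change ⁅(x : G) * y, g⁆ = ⁅(x : G), g⁆ * ⁅(y : G), g⁆
    calc ⁅(x : G) * y, g⁆ = (x * ⁅(y : G), g⁆) * g * (x : G)⁻¹ * g⁻¹ := by
          simp only [commutatorElement_def]; group
      _ = ⁅(y : G), g⁆ * ⁅(x : G), g⁆ := by rw [h]; simp only [commutatorElement_def]; group
      _ = _ := (Subgroup.mem_center_iff.1 (hK y y.2) _).symm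

/-- The homomorphism `x ↦ ⁅x, g⁆` on `K` has finitely generated abelian torsion image, hence finite
image, and its kernel centralizes `g`. -/
theorem Subgroup.finiteIndex_centralizer_of_central_commutators {G : Type*} [Group G] [Group.FG G]
    (K : Subgroup G) [K.FiniteIndex] (g : G) (hK : ∀ x ∈ K, ⁅x, g⁆ ∈ Subgroup.center G)
    (ht : ∀ x ∈ _root_.commutator G, IsOfFinOrder x) : (Subgroup.centralizer {g}).FiniteIndex := by
  set φ := K.commutatorHomOfCentral g hK with hφ
  have hfin : Finite φ.range := by
    have hcomm (x y : φ.range) : x * y = y * x :=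
      Subtype.ext (Subtype.ext (Subgroup.mem_center_iff.1 y.1.2 x.1))
    let _ : CommGroup φ.range := { mul_comm := hcomm }
    refine CommGroup.finite_of_fg_isMulTorsion _ fun x => ?_
    obtain ⟨_, k, rfl⟩ := x
    have := ht ⁅(k : G), g⁆ (Subgroup.commutator_mem_commutator trivial trivial)
    refine (Function.Injective.isOfFinOrder_iff (f := (Subgroup.center G).subtype.comp
      φ.range.subtype) (Subtype.val_injective.comp Subtype.val_injective)).1 ?_
    exact this
  have hker : φ.ker.FiniteIndex := Subgroup.finiteIndex_ker φ
  have hmap : (φ.ker.map K.subtype).FiniteIndex := by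
    refine ⟨?_⟩
    rw [Subgroup.index_map_subtype]
    exact mul_ne_zero hker.index_ne_zero Subgroup.FiniteIndex.index_ne_zero
  refine Subgroup.finiteIndex_of_le (H := φ.ker.map K.subtype) ?_
  rintro _ ⟨x, hx, rfl⟩
  have h1 : ⁅(x : G), g⁆ = 1 := congrArg Subtype.val (MonoidHom.mem_ker.1 hx)
  rw [commutatorElement_eq_one_iff_mul_comm] at h1
  rw [Subgroup.mem_centralizer_singleton_iff]
  exact h1

/-- Induction along `G/Z(G)`: the second center `K` then has finite index, so each generator has a
centralizer of finite index, and the center is the intersection of these finitely many centralizers.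
-/
theorem Group.IsNilpotent.finiteIndex_center_of_isOfFinOrder_commutator (G : Type*) [Group G]
    [Group.IsNilpotent G] (hfg : Group.FG G) (ht : ∀ x ∈ commutator G, IsOfFinOrder x) :
    (Subgroup.center G).FiniteIndex := by
  revert hfg ht
  refine Group.nilpotent_center_quotient_ind (P := fun G _ _ => Group.FG G →
    (∀ x ∈ commutator G, IsOfFinOrder x) → (Subgroup.center G).FiniteIndex) G ?_ ?_
  · intro G _ _ _ _
    infer_instance
  · intro G _ _ ih hfg ht
    have hQ : (Subgroup.center (G ⧸ Subgroup.center G)).FiniteIndex := by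
      refine ih inferInstance fun x hx => ?_
      have hx' : x ∈ (commutator G).map (QuotientGroup.mk' (Subgroup.center G)) := by
        rw [commutator_def, Subgroup.map_commutator, Subgroup.map_top_of_surjective _
          (QuotientGroup.mk'_surjective _)]
        exact hx
      obtain ⟨y, hy, rfl⟩ := hx'
      exact MonoidHom.isOfFinOrder _ (ht y hy)
    set K := (Subgroup.center (G ⧸ Subgroup.center G)).comap
      (QuotientGroup.mk' (Subgroup.center G)) with hKdef
    have hKfin : K.FiniteIndex := ⟨by
      rw [hKdef, Subgroup.index_comap_of_surjective _ (QuotientGroup.mk'_surjective _)]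
      exact hQ.index_ne_zero⟩
    have hK : ∀ g, ∀ x ∈ K, ⁅x, g⁆ ∈ Subgroup.center G := fun g x hx => by
      rw [hKdef, ← Subgroup.upperCentralSeriesStep_eq_comap_center] at hx
      exact hx g
    obtain ⟨s, hs⟩ := hfg.1
    rw [Subgroup.center_eq_iInf hs]
    refine Subgroup.finiteIndex_iInf' (s := s) _ fun g _ => ?_
    exact Subgroup.finiteIndex_centralizer_of_central_commutators K g (hK g) ht

theorem Group.IsNilpotent.finite_commutator_of_isOfFinOrder (G : Type*) [Group G]
    [Group.IsNilpotent G] [hfg : Group.FG G] (ht : ∀ x ∈ commutator G, IsOfFinOrder x) :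
    Finite (commutator G) := by
  have := Group.IsNilpotent.finiteIndex_center_of_isOfFinOrder_commutator G hfg ht
  have := Subgroup.finite_commutatorSet_of_finiteIndex_center G
  infer_instance

theorem Group.IsNilpotent.finite_of_isOfFinOrder (G : Type*) [Group G]
    [Group.IsNilpotent G] [hfg : Group.FG G] (ht : ∀ x : G, IsOfFinOrder x) : Finite G := by
  have := Group.IsNilpotent.finiteIndex_center_of_isOfFinOrder_commutator G hfg fun x _ => ht x
  have hc : Finite (Subgroup.center G) := by
    have hcomm (x y : Subgroup.center G) : x * y = y * x :=
      Subtype.ext (Subgroup.mem_center_iff.1 y.2 x.1)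
    let _ : CommGroup (Subgroup.center G) := { mul_comm := hcomm }
    refine CommGroup.finite_of_fg_isMulTorsion _ fun x => ?_
    refine (Function.Injective.isOfFinOrder_iff (f := (Subgroup.center G).subtype)
      Subtype.val_injective).1 ?_
    exact ht x
  exact (Subgroup.finite_iff_finite_and_finiteIndex (Subgroup.center G)).2 ⟨hc, this⟩

/-! ### Elements of `p`-power order in nilpotent groups. -/

/-- The central quotient is a finite `p`-group, and by the quantitative form of Schur's theorem the
order of `G'` divides a power of its order. -/
theorem Group.IsNilpotent.isPGroup_commutator_of_quotient_center {p : ℕ} [hp : Fact p.Prime]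
    (G : Type*) [Group G] [Group.IsNilpotent G] [Group.FG G]
    (h : IsPGroup p (G ⧸ Subgroup.center G)) : IsPGroup p (commutator G) := by
  have hfin : Finite (G ⧸ Subgroup.center G) :=
    Group.IsNilpotent.finite_of_isOfFinOrder _ (h.isOfFinOrder hp.out.ne_zero)
  have : (Subgroup.center G).FiniteIndex := Subgroup.finiteIndex_of_finite_quotient
  have := Subgroup.finite_commutatorSet_of_finiteIndex_center G
  obtain ⟨n, hn⟩ := IsPGroup.iff_card.1 h
  have hd := Subgroup.card_commutator_dvd_index_center_pow G
  rw [Subgroup.index, hn, ← pow_mul] at hd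
  obtain ⟨m, -, hm⟩ := (Nat.dvd_prime_pow hp.out).1 hd
  exact IsPGroup.of_card hm

theorem IsPGroup.of_normal_of_quotient {p : ℕ} {G : Type*} [Group G] (N : Subgroup G) [N.Normal]
    (hN : IsPGroup p N) (hQ : IsPGroup p (G ⧸ N)) : IsPGroup p G := by
  intro g
  obtain ⟨k, hk⟩ := hQ g
  rw [← QuotientGroup.mk_pow, QuotientGroup.eq_one_iff] at hk
  obtain ⟨l, hl⟩ := hN ⟨_, hk⟩
  refine ⟨k + l, ?_⟩
  rw [pow_add, pow_mul]
  exact congrArg Subtype.val hl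

theorem IsPGroup.of_closure_eq_top_of_comm {p : ℕ} {G : Type*} [Group G]
    (hcomm : ∀ a b : G, a * b = b * a) (s : Set G) (hs : Subgroup.closure s = ⊤)
    (h : ∀ x ∈ s, ∃ k : ℕ, x ^ p ^ k = 1) : IsPGroup p G := by
  intro g
  have hg : g ∈ Subgroup.closure s := hs ▸ Subgroup.mem_top g
  induction hg using Subgroup.closure_induction with
  | mem x hx => exact h x hx
  | one => exact ⟨0, by simp⟩
  | mul x y _ _ hx hy =>
    obtain ⟨k, hk⟩ := hx
    obtain ⟨l, hl⟩ := hy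
    refine ⟨k + l, ?_⟩
    rw [(show Commute x y from hcomm x y).mul_pow, pow_add, pow_mul, hk, one_pow, one_mul,
      mul_comm, pow_mul, hl, one_pow]
  | inv x _ hx =>
    obtain ⟨k, hk⟩ := hx
    exact ⟨k, by rw [inv_pow, hk, inv_one]⟩

theorem Subgroup.exists_finset_mem_closure {G : Type*} [Group G] {s : Set G} {x : G}
    (hx : x ∈ Subgroup.closure s) : ∃ t : Finset G, (t : Set G) ⊆ s ∧
      x ∈ Subgroup.closure (t : Set G) := by
  classical
  induction hx using Subgroup.closure_induction with
  | mem x hx => exact ⟨{x}, by simpa using hx, Subgroup.subset_closure (by simp)⟩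
  | one => exact ⟨∅, by simp, one_mem _⟩
  | mul x y _ _ hx hy =>
    obtain ⟨t, ht, hx⟩ := hx
    obtain ⟨u, hu, hy⟩ := hy
    refine ⟨t ∪ u, by simp [ht, hu], mul_mem ?_ ?_⟩
    · exact Subgroup.closure_mono (by simp) hx
    · exact Subgroup.closure_mono (by simp) hy
  | inv x _ hx =>
    obtain ⟨t, ht, hx⟩ := hx
    exact ⟨t, ht, inv_mem hx⟩

/-- By induction `G/Z(G)` is a `p`-group. Each element lies in a subgroup `M` generated by finitely
many of the given generators; `M'` is a `p`-group by Schur, and the abelianization of `M` is one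
because its generators have `p`-power order. -/
theorem Group.IsNilpotent.isPGroup_of_closure_eq_top {p : ℕ} [hp : Fact p.Prime] (G : Type*)
    [Group G] [Group.IsNilpotent G] (s : Set G) (hs : Subgroup.closure s = ⊤)
    (h : ∀ x ∈ s, ∃ k : ℕ, x ^ p ^ k = 1) : IsPGroup p G := by
  revert s
  refine Group.nilpotent_center_quotient_ind (P := fun G _ _ => ∀ s : Set G,
    Subgroup.closure s = ⊤ → (∀ x ∈ s, ∃ k : ℕ, x ^ p ^ k = 1) → IsPGroup p G) G ?_ ?_
  · exact fun G _ _ s _ _ g => ⟨0, Subsingleton.elim _ _⟩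
  · intro G _ _ ih s hs h
    have hQ : IsPGroup p (G ⧸ Subgroup.center G) := by
      refine ih (QuotientGroup.mk' _ '' s) ?_ ?_
      · rw [← MonoidHom.map_closure, hs, Subgroup.map_top_of_surjective _
          (QuotientGroup.mk'_surjective _)]
      · rintro _ ⟨x, hx, rfl⟩
        obtain ⟨k, hk⟩ := h x hx
        exact ⟨k, by rw [← map_pow, hk, map_one]⟩
    intro g
    obtain ⟨t, hts, hgt⟩ := Subgroup.exists_finset_mem_closure (hs ▸ Subgroup.mem_top g :
      g ∈ Subgroup.closure s)
    set M := Subgroup.closure (t : Set G) with hM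
    have hMfg : Group.FG M := Group.closure_finset_fg t
    have hMq : IsPGroup p (M ⧸ Subgroup.center M) := by
      intro x
      induction x using QuotientGroup.induction_on with
      | H x =>
        obtain ⟨k, hk⟩ := hQ (x : G)
        refine ⟨k, ?_⟩
        rw [← QuotientGroup.mk_pow, QuotientGroup.eq_one_iff] at hk ⊢
        rw [Subgroup.mem_center_iff] at hk ⊢
        intro y
        ext
        exact hk y
    have hM' := Group.IsNilpotent.isPGroup_commutator_of_quotient_center M hMq
    have hMp : IsPGroup p M := by
      refine IsPGroup.of_normal_of_quotient (commutator M) hM' ?_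
      have hcl : Subgroup.closure (((↑) : M → G) ⁻¹' (t : Set G)) = ⊤ :=
        Subgroup.closure_closure_coe_preimage
      refine IsPGroup.of_closure_eq_top_of_comm
        (fun a b => mul_comm (G := Abelianization M) a b)
        (QuotientGroup.mk' (commutator M) '' (((↑) : M → G) ⁻¹' (t : Set G))) ?_ ?_
      · rw [← MonoidHom.map_closure, hcl, Subgroup.map_top_of_surjective _
          (QuotientGroup.mk'_surjective _)]
      · rintro _ ⟨x, hx, rfl⟩
        obtain ⟨k, hk⟩ := h x (hts hx)
        exact ⟨k, by rw [← map_pow, show x ^ p ^ k = 1 from Subtype.ext hk, map_one]⟩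
    obtain ⟨k, hk⟩ := hMp ⟨g, hgt⟩
    exact ⟨k, congrArg Subtype.val hk⟩

/-- A nontrivial element of `N` at the lowest possible level of the upper central series works: its
commutators stay in `N` and lie one level lower, so they are trivial. -/
theorem Group.IsNilpotent.exists_mem_center_of_normal {G : Type*} [Group G]
    [hG : Group.IsNilpotent G] (N : Subgroup G) [N.Normal] (hN : N ≠ ⊥) :
    ∃ x ∈ N, x ≠ 1 ∧ x ∈ Subgroup.center G := by
  classical
  have hex : ∃ n, ∃ x ∈ N, x ≠ 1 ∧ x ∈ Subgroup.upperCentralSeries G n := by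
    obtain ⟨n, hn⟩ := hG.nilpotent
    obtain ⟨x, hx1⟩ := N.ne_bot_iff_exists_ne_one.1 hN
    exact ⟨n, x, x.2, by simpa using hx1, hn ▸ Subgroup.mem_top _⟩
  obtain ⟨x, hxN, hx1, hx⟩ := Nat.find_spec hex
  refine ⟨x, hxN, hx1, ?_⟩
  rcases hm : Nat.find hex with _ | m
  · rw [hm] at hx
    exact absurd (by simpa using hx) hx1
  rw [hm] at hx
  rw [Subgroup.mem_center_iff]
  intro y
  have hc := Subgroup.mem_upperCentralSeries_succ_iff.1 hx y
  have hcN : ⁅x, y⁆ ∈ N := by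
    rw [commutatorElement_def, mul_assoc, mul_assoc, ← mul_assoc y]
    exact mul_mem hxN (Subgroup.Normal.conj_mem inferInstance _ (inv_mem hxN) _)
  by_contra hne
  refine Nat.find_min hex (m := m) (by omega) ⟨_, hcN, fun h1 => hne ?_, hc⟩
  exact (commutatorElement_eq_one_iff_mul_comm.1 h1).symm

theorem IsPGroup.exists_orderOf_eq {p : ℕ} [hp : Fact p.Prime] {G : Type*} [Group G] {x : G}
    (hx : x ≠ 1) {k : ℕ} (hk : x ^ p ^ k = 1) : ∃ m : ℕ, orderOf (x ^ m) = p := by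
  obtain ⟨l, hl⟩ := exists_orderOf_eq_prime_pow_iff.2 ⟨k, hk⟩
  rcases l with _ | l
  · exact absurd (orderOf_eq_one_iff.1 (by simpa using hl)) hx
  refine ⟨p ^ l, ?_⟩
  rw [orderOf_pow_of_dvd (pow_ne_zero _ hp.out.ne_zero) (by rw [hl]; exact pow_dvd_pow p l.le_succ),
    hl, pow_succ, Nat.mul_div_cancel_left _ (pow_pos hp.out.pos l)]

theorem Group.IsNilpotent.exists_center_orderOf_eq_of_normal {p : ℕ} [hp : Fact p.Prime] {G : Type*}
    [Group G] [Group.IsNilpotent G] (N : Subgroup G) [N.Normal] (hN : N ≠ ⊥)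
    (hNp : IsPGroup p N) : ∃ z ∈ N, z ∈ Subgroup.center G ∧ orderOf z = p := by
  obtain ⟨x, hxN, hx1, hxc⟩ := Group.IsNilpotent.exists_mem_center_of_normal N hN
  obtain ⟨k, hk⟩ := hNp ⟨x, hxN⟩
  obtain ⟨m, hm⟩ := IsPGroup.exists_orderOf_eq hx1 (congrArg Subtype.val hk : x ^ p ^ k = 1)
  exact ⟨x ^ m, pow_mem hxN m, pow_mem hxc m, hm⟩

/-- The normal closure of `g` is generated by conjugates of order `p`, hence is a nontrivial normal
`p`-subgroup. -/
theorem Group.IsNilpotent.exists_center_orderOf_eq {p : ℕ} [hp : Fact p.Prime] {G : Type*}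
    [Group G] [Group.IsNilpotent G] (g : G) (hg : orderOf g = p) :
    ∃ z ∈ Subgroup.center G, orderOf z = p := by
  set N := Subgroup.normalClosure {g} with hN
  have hgN : g ∈ N := Subgroup.subset_normalClosure rfl
  have hNp : IsPGroup p N := by
    refine Group.IsNilpotent.isPGroup_of_closure_eq_top N
      (((↑) : N → G) ⁻¹' (Group.conjugatesOfSet {g})) ?_ ?_
    · exact Subgroup.closure_closure_coe_preimage
    · rintro x hx
      obtain ⟨y, hy, hc⟩ := Group.mem_conjugatesOfSet_iff.1 hx
      obtain rfl : y = g := hy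
      obtain ⟨c, hc⟩ := isConj_iff.1 hc
      refine ⟨1, Subtype.ext ?_⟩
      rw [pow_one, Subgroup.coe_pow, ← hc, conj_pow, ← hg, pow_orderOf_eq_one]
      simp
  have hN1 : N ≠ ⊥ := fun hb => by
    rw [hb, Subgroup.mem_bot] at hgN
    rw [hgN, orderOf_one] at hg
    exact hp.out.one_lt.ne hg
  obtain ⟨z, -, hz⟩ := Group.IsNilpotent.exists_center_orderOf_eq_of_normal N hN1 hNp
  exact ⟨z, hz⟩

/-! ### Strong Lie series and nilpotent unit groups. -/

/-- The chain of two-sided ideals of a ring that starts with the whole ring and in which each term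
is generated by the ring commutators of the previous term with the ring. -/
def strongLieSeries (R : Type*) [Ring R] : ℕ → TwoSidedIdeal R
  | 0 => ⊤
  | n + 1 => TwoSidedIdeal.span {x | ∃ a ∈ strongLieSeries R n, ∃ b, x = a * b - b * a}

theorem strongLieSeries_commutator_mem {R : Type*} [Ring R] {n : ℕ} {a : R}
    (ha : a ∈ strongLieSeries R n) (b : R) : a * b - b * a ∈ strongLieSeries R (n + 1) :=
  TwoSidedIdeal.subset_span ⟨a, ha, b, rfl⟩

theorem strongLieSeries_succ_le {R : Type*} [Ring R] {n : ℕ} {I : TwoSidedIdeal R}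
    (h : ∀ a ∈ strongLieSeries R n, ∀ b, a * b - b * a ∈ I) : strongLieSeries R (n + 1) ≤ I := by
  refine TwoSidedIdeal.span_le.2 ?_
  rintro _ ⟨a, ha, b, rfl⟩
  exact h a ha b

theorem map_mem_strongLieSeries {R S : Type*} [Ring R] [Ring S] (φ : R →+* S) (n : ℕ) {x : R}
    (hx : x ∈ strongLieSeries R n) : φ x ∈ strongLieSeries S n := by
  induction n generalizing x with
  | zero => exact TwoSidedIdeal.mem_top _
  | succ n ih =>
    have hle : strongLieSeries R (n + 1) ≤ (strongLieSeries S (n + 1)).comap φ := by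
      refine strongLieSeries_succ_le fun a ha b => ?_
      rw [TwoSidedIdeal.mem_comap, map_sub, map_mul, map_mul]
      exact strongLieSeries_commutator_mem (ih ha) _
    exact (TwoSidedIdeal.mem_comap φ).1 (hle hx)

/-- The two-sided ideal of the multiples `c * x`, `x ∈ I`, of a two-sided ideal `I` by a central
element `c`. -/
def TwoSidedIdeal.centralMul {R : Type*} [Ring R] (c : R) (hc : ∀ b, c * b = b * c)
    (I : TwoSidedIdeal R) : TwoSidedIdeal R :=
  TwoSidedIdeal.mk' {x | ∃ y ∈ I, x = c * y} ⟨0, I.zero_mem, by simp⟩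
    (by rintro _ _ ⟨x, hx, rfl⟩ ⟨y, hy, rfl⟩; exact ⟨x + y, I.add_mem hx hy, by rw [mul_add]⟩)
    (by rintro _ ⟨x, hx, rfl⟩; exact ⟨-x, I.neg_mem hx, by rw [mul_neg]⟩)
    (by
      rintro x _ ⟨y, hy, rfl⟩
      exact ⟨x * y, I.mul_mem_left _ _ hy, by rw [← mul_assoc, ← hc, mul_assoc]⟩)
    (by rintro _ y ⟨x, hx, rfl⟩; exact ⟨x * y, I.mul_mem_right _ _ hx, by rw [mul_assoc]⟩)

theorem TwoSidedIdeal.mem_centralMul {R : Type*} [Ring R] {c : R} {hc : ∀ b, c * b = b * c}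
    {I : TwoSidedIdeal R} {x : R} : x ∈ I.centralMul c hc ↔ ∃ y ∈ I, x = c * y :=
  TwoSidedIdeal.mem_mk' ..

/-- A central factor passes through commutators: `[c y, b] = c [y, b]`. After `n` terms the series
restarts inside `c R`. -/
theorem strongLieSeries_add_le_centralMul {R : Type*} [Ring R] {c : R} (hc : ∀ b, c * b = b * c)
    {n : ℕ} (h : ∀ x ∈ strongLieSeries R n, ∃ y, x = c * y) (m : ℕ) :
    strongLieSeries R (n + m) ≤ (strongLieSeries R m).centralMul c hc := by
  induction m with
  | zero =>
    intro x hx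
    obtain ⟨y, hy⟩ := h x hx
    exact TwoSidedIdeal.mem_centralMul.2 ⟨y, TwoSidedIdeal.mem_top _, hy⟩
  | succ m ih =>
    refine strongLieSeries_succ_le fun a ha b => ?_
    obtain ⟨y, hy, rfl⟩ := TwoSidedIdeal.mem_centralMul.1 (ih ha)
    refine TwoSidedIdeal.mem_centralMul.2 ⟨_, strongLieSeries_commutator_mem hy b, ?_⟩
    rw [mul_sub, mul_assoc, ← mul_assoc b, ← hc, mul_assoc]

theorem exists_eq_pow_mul_of_mem_strongLieSeries {R : Type*} [Ring R] {c : R}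
    (hc : ∀ b, c * b = b * c) {n : ℕ} (h : ∀ x ∈ strongLieSeries R n, ∃ y, x = c * y) (j : ℕ)
    {x : R} (hx : x ∈ strongLieSeries R (n * j)) : ∃ y, x = c ^ j * y := by
  induction j generalizing x with
  | zero => exact ⟨x, by simp⟩
  | succ j ih =>
    -- The first `n` terms yield one factor `c`; the remaining `n * j` are left for the induction
    -- hypothesis.
    rw [Nat.mul_succ, add_comm] at hx
    obtain ⟨y, hy, rfl⟩ := TwoSidedIdeal.mem_centralMul.1
      (strongLieSeries_add_le_centralMul hc h _ hx)
    obtain ⟨w, rfl⟩ := ih hy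
    exact ⟨w, by rw [← mul_assoc, pow_succ']⟩

/-- The units congruent to `1` modulo a two-sided ideal. -/
def TwoSidedIdeal.congruenceUnits {R : Type*} [Ring R] (I : TwoSidedIdeal R) : Subgroup Rˣ where
  carrier := {u | (u : R) - 1 ∈ I}
  one_mem' := by simp [I.zero_mem]
  mul_mem' := by
    intro u v hu hv
    change ((u * v : Rˣ) : R) - 1 ∈ I
    have : ((u * v : Rˣ) : R) - 1 = (u - 1) * v + (v - 1) := by push_cast; noncomm_ring
    rw [this]
    exact I.add_mem (I.mul_mem_right _ _ hu) hv
  inv_mem' := by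
    intro u hu
    change ((u⁻¹ : Rˣ) : R) - 1 ∈ I
    have : ((u⁻¹ : Rˣ) : R) - 1 = -(((u⁻¹ : Rˣ) : R) * (u - 1)) := by
      rw [mul_sub, Units.inv_mul]; noncomm_ring
    rw [this]
    exact I.neg_mem (I.mul_mem_left _ _ hu)

/-- The congruence subgroups of the series form a descending central series, since `⁅u, v⁆ - 1 = [u
- 1, v] u⁻¹ v⁻¹`. -/
theorem Units.isNilpotent_of_strongLieSeries_eq_bot {R : Type*} [Ring R] {n : ℕ}
    (h : strongLieSeries R n = ⊥) : Group.IsNilpotent Rˣ := by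
  refine (Subgroup.nilpotent_iff_finite_descending_central_series _).2
    ⟨n, fun k => (strongLieSeries R k).congruenceUnits, ⟨?_, fun u k hu v => ?_⟩, ?_⟩
  · exact eq_top_iff.2 fun u _ => trivial
  · change ((⁅u, v⁆ : Rˣ) : R) - 1 ∈ strongLieSeries R (k + 1)
    have h1 : ((⁅u, v⁆ : Rˣ) : R) - 1 =
        (((u : R) - 1) * v - v * (u - 1)) * (((u⁻¹ : Rˣ) : R) * ((v⁻¹ : Rˣ) : R)) := by
      have h2 : (v : R) * u * (((u⁻¹ : Rˣ) : R) * ((v⁻¹ : Rˣ) : R)) = 1 := by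
        rw [mul_assoc, ← mul_assoc (u : R)]; simp
      have h3 : ((⁅u, v⁆ : Rˣ) : R) = u * v * (((u⁻¹ : Rˣ) : R) * ((v⁻¹ : Rˣ) : R)) := by
        simp [commutatorElement_def, mul_assoc]
      have h4 : ((u : R) - 1) * v - v * (u - 1) = u * v - v * u := by noncomm_ring
      rw [h3, h4, sub_mul, h2]
    rw [h1]
    exact TwoSidedIdeal.mul_mem_right _ _ _ (strongLieSeries_commutator_mem hu _)
  · refine eq_bot_iff.2 fun u hu => ?_
    have hu' : (u : R) - 1 ∈ strongLieSeries R n := hu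
    rw [h, TwoSidedIdeal.mem_bot, sub_eq_zero] at hu'
    exact Units.ext hu'

/-! ### Group algebras of nilpotent groups whose commutator subgroup is a finite `p`-group. -/

theorem MonoidAlgebra.charP (F G : Type*) [Field F] [Group G] (p : ℕ) [CharP F p] :
    CharP (MonoidAlgebra F G) p :=
  charP_of_injective_algebraMap (RingHom.injective (algebraMap F (MonoidAlgebra F G))) p

theorem MonoidAlgebra.exists_eq_of_sub_one_mul_of_mapDomain_eq_zero {F G : Type*} [Field F]
    [Group G] {z : G} (hz : z ∈ Subgroup.center G) [(Subgroup.zpowers z).Normal]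
    (hfin : IsOfFinOrder z) {x : MonoidAlgebra F G}
    (hx : MonoidAlgebra.mapDomainRingHom F (QuotientGroup.mk' (Subgroup.zpowers z)) x = 0) :
    ∃ y, x = (MonoidAlgebra.of F G z - 1) * y := by
  -- Replacing every group element by its coset representative changes `x` only by a multiple of `z
  -- - 1`.
  have key : ∀ x : MonoidAlgebra F G, ∃ y, x - MonoidAlgebra.mapDomain Quotient.out
      (MonoidAlgebra.mapDomainRingHom F (QuotientGroup.mk' (Subgroup.zpowers z)) x) =
        (MonoidAlgebra.of F G z - 1) * y := by
    intro x
    induction x using MonoidAlgebra.induction_linear with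
    | zero => exact ⟨0, by simp⟩
    | add x y hx hy =>
      obtain ⟨u, hu⟩ := hx
      obtain ⟨v, hv⟩ := hy
      refine ⟨u + v, ?_⟩
      rw [map_add, MonoidAlgebra.mapDomain_add, mul_add, ← hu, ← hv]
      abel
    | single g r =>
      obtain ⟨⟨c, hc⟩, hout⟩ := QuotientGroup.mk_out_eq_mul (Subgroup.zpowers z) g
      -- Finite order allows a natural exponent, so that `1 - z^k` factors by a geometric sum.
      obtain ⟨k, rfl⟩ := (IsOfFinOrder.mem_powers_iff_mem_zpowers hfin).2 hc
      have h1 : MonoidAlgebra.mapDomain Quotient.out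
          (MonoidAlgebra.mapDomainRingHom F (QuotientGroup.mk' (Subgroup.zpowers z))
            (MonoidAlgebra.single g r)) =
          MonoidAlgebra.of F G z ^ k * MonoidAlgebra.single g r := by
        rw [MonoidAlgebra.mapDomainRingHom_apply, MonoidAlgebra.mapDomain_single,
          MonoidAlgebra.mapDomain_single, ← map_pow, MonoidAlgebra.of_apply,
          MonoidAlgebra.single_mul_single, one_mul, ← Subgroup.mem_center_iff.1 (pow_mem hz k) g]
        exact congrArg (fun a => MonoidAlgebra.single a r) hout
      refine ⟨-((∑ i ∈ Finset.range k, MonoidAlgebra.of F G z ^ i) *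
        MonoidAlgebra.single g r), ?_⟩
      rw [h1, mul_neg, ← mul_assoc, mul_geom_sum, sub_mul, one_mul, neg_sub]
  obtain ⟨y, hy⟩ := key x
  refine ⟨y, ?_⟩
  rw [← hy, hx, MonoidAlgebra.mapDomain_zero, sub_zero]

/-- Induction on the order of `H'`. For a central `z` of order `p` in `H'`, the series of the
algebra of `H/⟨z⟩` vanishes at some `n`, so the `n`-th term for `H` lies in the multiples of `z -
1`. -/
theorem MonoidAlgebra.exists_strongLieSeries_eq_bot {p : ℕ} [hp : Fact p.Prime] (F H : Type*)
    [Field F] [CharP F p] [Group H] [Group.IsNilpotent H] [Finite (commutator H)]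
    (hH : IsPGroup p (commutator H)) :
    ∃ n, strongLieSeries (MonoidAlgebra F H) n = ⊥ := by
  induction hk : Nat.card (commutator H) using Nat.strong_induction_on generalizing H with
  | _ k ih =>
  by_cases hb : commutator H = ⊥
  · have hcomm := (commutator_eq_bot_iff H).1 hb
    let _ : CommGroup H := { mul_comm := hcomm.is_comm.comm }
    refine ⟨1, eq_bot_iff.2 (strongLieSeries_succ_le fun a _ b => ?_)⟩
    rw [TwoSidedIdeal.mem_bot, sub_eq_zero]
    exact mul_comm a b
  · obtain ⟨z, hzc, hz, hzp⟩ := Group.IsNilpotent.exists_center_orderOf_eq_of_normal _ hb hH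
    have hnorm : (Subgroup.zpowers z).Normal :=
      ⟨fun x hx g => by
        obtain ⟨k, rfl⟩ := hx
        have := Subgroup.mem_center_iff.1 (zpow_mem hz k) g
        simp only [this, mul_inv_cancel_right]
        exact ⟨k, rfl⟩⟩
    set π := QuotientGroup.mk' (Subgroup.zpowers z) with hπ
    have hmap : commutator (H ⧸ Subgroup.zpowers z) = (commutator H).map π := by
      rw [commutator_def, commutator_def, Subgroup.map_commutator, Subgroup.map_top_of_surjective _
          (QuotientGroup.mk'_surjective _)]
    set ψ : commutator H →* commutator (H ⧸ Subgroup.zpowers z) :=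
      (π.comp (commutator H).subtype).codRestrict _ fun x => hmap ▸ ⟨x, x.2, rfl⟩ with hψ
    have hsurj : Function.Surjective ψ := by
      rintro ⟨y, hy⟩
      obtain ⟨x, hx, rfl⟩ := hmap ▸ hy
      exact ⟨⟨x, hx⟩, rfl⟩
    have hfin : Finite (commutator (H ⧸ Subgroup.zpowers z)) := Finite.of_surjective ψ hsurj
    have hz1 : z ≠ 1 := fun h => hp.out.one_lt.ne (by rw [← hzp, h, orderOf_one])
    have hlt : Nat.card (commutator (H ⧸ Subgroup.zpowers z)) < k := by
      rw [← hk]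
      refine lt_of_le_of_ne (Nat.card_le_card_of_surjective ψ hsurj) fun hcard => hz1 ?_
      have hinj := ((Nat.bijective_iff_surjective_and_card ψ).2 ⟨hsurj, hcard.symm⟩).1
      have : (⟨z, hzc⟩ : commutator H) = 1 := hinj (by
        rw [map_one]
        exact Subtype.ext ((QuotientGroup.eq_one_iff z).2 (Subgroup.mem_zpowers z)))
      exact congrArg Subtype.val this
    have : Group.IsNilpotent (H ⧸ Subgroup.zpowers z) :=
      Group.nilpotent_of_surjective π (QuotientGroup.mk'_surjective _)
    obtain ⟨n, hn⟩ := ih _ hlt _ (hH.of_surjective ψ hsurj) rfl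
    have hc : ∀ b : MonoidAlgebra F H, (MonoidAlgebra.of F H z - 1) * b =
        b * (MonoidAlgebra.of F H z - 1) := by
      intro b
      rw [sub_mul, mul_sub, one_mul, mul_one]
      congr 1
      induction b using MonoidAlgebra.induction_linear with
      | zero => simp
      | add x y hx hy => rw [mul_add, add_mul, hx, hy]
      | single g r =>
        rw [MonoidAlgebra.of_apply, MonoidAlgebra.single_mul_single,
          MonoidAlgebra.single_mul_single, Subgroup.mem_center_iff.1 hz g, one_mul, mul_one]
    have hdiv : ∀ x ∈ strongLieSeries (MonoidAlgebra F H) n,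
        ∃ y, x = (MonoidAlgebra.of F H z - 1) * y := by
      intro x hx
      refine MonoidAlgebra.exists_eq_of_sub_one_mul_of_mapDomain_eq_zero hz
        (orderOf_pos_iff.1 (hzp ▸ hp.out.pos)) ?_
      have := map_mem_strongLieSeries (MonoidAlgebra.mapDomainRingHom F π) n hx
      rwa [hn, TwoSidedIdeal.mem_bot] at this
    -- Repeating the `n` steps `p` times produces the factor `(z - 1)^p = z^p - 1 = 0`.
    refine ⟨n * p, eq_bot_iff.2 fun x hx => ?_⟩
    obtain ⟨y, rfl⟩ := exists_eq_pow_mul_of_mem_strongLieSeries hc hdiv p hx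
    have := MonoidAlgebra.charP F H p
    rw [sub_pow_char_of_commute p (Commute.one_right _), ← map_pow, ← hzp, pow_orderOf_eq_one,
      map_one, one_pow, sub_self, zero_mul]
    exact TwoSidedIdeal.zero_mem _

/-! ### Normalized units built from an element of order `p`. -/

/-- The group elements as normalized units. -/
noncomputable def normalizedUnits.of (F G : Type*) [Field F] [Group G] :
    G →* normalizedUnits F G :=
  ((Units.map (MonoidAlgebra.of F G)).comp toUnits.toMonoidHom).codRestrict _ fun g => by
    rw [mem_normalizedUnits]
    simp [groupAugmentation]

theorem normalizedUnits.coe_of (F : Type*) {G : Type*} [Field F] [Group G] (g : G) :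
    ((normalizedUnits.of F G g : (MonoidAlgebra F G)ˣ) : MonoidAlgebra F G) =
      MonoidAlgebra.of F G g := rfl

theorem normalizedUnits.coe_of_inv (F : Type*) {G : Type*} [Field F] [Group G] (g : G) :
    (((normalizedUnits.of F G g : (MonoidAlgebra F G)ˣ)⁻¹ : (MonoidAlgebra F G)ˣ) :
      MonoidAlgebra F G) = MonoidAlgebra.of F G g⁻¹ := rfl

theorem normalizedUnits.of_injective (F G : Type*) [Field F] [Group G] :
    Function.Injective (normalizedUnits.of F G) := fun _ _ h =>
  MonoidAlgebra.of_injective (R := F) (congrArg (fun u : normalizedUnits F G =>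
    ((u : (MonoidAlgebra F G)ˣ) : MonoidAlgebra F G)) h)

theorem IsLocallyNilpotentGroup.of_injective {G H : Type*} [Group G] [Group H] (φ : G →* H)
    (hφ : Function.Injective φ) (hH : IsLocallyNilpotentGroup H) : IsLocallyNilpotentGroup G := by
  classical
  rintro S ⟨s, hs⟩
  have := hH (S.map φ) ⟨s.image φ, by rw [Finset.coe_image, ← MonoidHom.map_closure, hs]⟩
  exact Group.nilpotent_of_mulEquiv (S.equivMapOfInjective φ hφ).symm

/-- The sum of the first `p` powers of a group element in the group algebra. -/
noncomputable def MonoidAlgebra.powerSum (F : Type*) {G : Type*} [Field F] [Group G] (p : ℕ)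
    (z : G) : MonoidAlgebra F G :=
  ∑ i ∈ Finset.range p, MonoidAlgebra.of F G (z ^ i)

theorem MonoidAlgebra.powerSum_mul_of_sub_one {F G : Type*} [Field F] [Group G] {p : ℕ} {z : G}
    (hz : z ^ p = 1) :
    MonoidAlgebra.powerSum F p z * (MonoidAlgebra.of F G z - 1) = 0 := by
  simp only [MonoidAlgebra.powerSum, map_pow]
  rw [geom_sum_mul, ← map_pow, hz, map_one, sub_self]

/-- Multiplication by `z` fixes `e`, so `e² = p e = 0`. -/
theorem MonoidAlgebra.powerSum_mul_self {F G : Type*} [Field F] [Group G] {p : ℕ} [CharP F p]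
    {z : G} (hz : z ^ p = 1) :
    MonoidAlgebra.powerSum F p z * MonoidAlgebra.powerSum F p z = 0 := by
  have h1 : MonoidAlgebra.powerSum F p z * MonoidAlgebra.of F G z =
      MonoidAlgebra.powerSum F p z := by
    have := MonoidAlgebra.powerSum_mul_of_sub_one (F := F) hz
    rwa [mul_sub, mul_one, sub_eq_zero] at this
  have h2 : ∀ i : ℕ, MonoidAlgebra.powerSum F p z * MonoidAlgebra.of F G (z ^ i) =
      MonoidAlgebra.powerSum F p z := by
    intro i
    induction i with
    | zero => rw [pow_zero, map_one, mul_one]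
    | succ i ih => rw [pow_succ, map_mul, ← mul_assoc, ih, h1]
  have := MonoidAlgebra.charP F G p
  conv_lhs => rw [MonoidAlgebra.powerSum.eq_1 F p z, Finset.mul_sum]
  rw [← MonoidAlgebra.powerSum.eq_1 F p z, Finset.sum_congr rfl fun i _ => h2 i, Finset.sum_const,
    Finset.card_range, nsmul_eq_mul, CharP.cast_eq_zero, zero_mul]

theorem MonoidAlgebra.commute_powerSum_of {F G : Type*} [Field F] [Group G] {p : ℕ} {z g : G}
    (h : Commute z g) : Commute (MonoidAlgebra.powerSum F p z) (MonoidAlgebra.of F G g) :=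
  Commute.sum_left _ _ _ fun i _ => (h.pow_left i).map (MonoidAlgebra.of F G)

theorem groupAugmentation_powerSum {F G : Type*} [Field F] [Group G] {p : ℕ} [CharP F p] (z : G) :
    groupAugmentation F G (MonoidAlgebra.powerSum F p z) = 0 := by
  simp [MonoidAlgebra.powerSum, groupAugmentation]

theorem MonoidAlgebra.exists_eq_pow_mul_of_powerSum_mul_of_eq {F G : Type*} [Field F] [Group G]
    {p : ℕ} {z a b : G} (hp : 0 < p) (hz : orderOf z = p)
    (h : MonoidAlgebra.powerSum F p z * MonoidAlgebra.of F G b =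
      MonoidAlgebra.powerSum F p z * MonoidAlgebra.of F G a) : ∃ i : ℕ, b = z ^ i * a := by
  classical
  by_contra! hne
  -- At `b` the left side has coefficient `1`, from `i = 0` alone because `z` has order exactly `p`;
  -- the right side would have coefficient `0`.
  have h' := congrArg (fun x : MonoidAlgebra F G => x.coeff b) h
  simp only [MonoidAlgebra.powerSum, Finset.sum_mul, MonoidAlgebra.coeff_sum,
    Finsupp.finsetSum_apply, MonoidAlgebra.of_apply, MonoidAlgebra.single_mul_single,
    one_mul, MonoidAlgebra.coeff_single, Finsupp.single_apply] at h'
  rw [Finset.sum_eq_single_of_mem 0 (Finset.mem_range.2 hp), Finset.sum_eq_zero] at h'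
  · simp at h'
  · intro i _
    rw [if_neg (hne i).symm]
  · intro i hi hi0
    rw [if_neg]
    intro hib
    rw [mul_eq_right] at hib
    exact Nat.not_dvd_of_pos_of_lt (Nat.pos_of_ne_zero hi0) (Finset.mem_range.1 hi)
      (hz ▸ orderOf_dvd_of_pow_eq_one hib)

theorem normalizedUnits.exists_eq_one_add_powerSum_mul {F G : Type*} [Field F] [Group G] {p : ℕ}
    [CharP F p] {z : G} (hz : z ^ p = 1) {x : MonoidAlgebra F G}
    (hx : Commute (MonoidAlgebra.powerSum F p z) x) :
    ∃ v : normalizedUnits F G,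
      ((v : (MonoidAlgebra F G)ˣ) : MonoidAlgebra F G) = 1 + MonoidAlgebra.powerSum F p z * x ∧
      (((v : (MonoidAlgebra F G)ˣ)⁻¹ : (MonoidAlgebra F G)ˣ) : MonoidAlgebra F G) =
        1 - MonoidAlgebra.powerSum F p z * x := by
  set e := MonoidAlgebra.powerSum F p z with he
  have hsq : e * x * (e * x) = 0 := by
    rw [hx.eq, mul_assoc x, ← hx.eq, ← mul_assoc e e, MonoidAlgebra.powerSum_mul_self hz, zero_mul, mul_zero]
  refine ⟨⟨⟨1 + e * x, 1 - e * x, ?_, ?_⟩, ?_⟩, rfl, rfl⟩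
  · rw [add_mul, one_mul, mul_sub, mul_one, hsq]; abel
  · rw [sub_mul, one_mul, mul_add, mul_one, hsq]; abel
  · rw [mem_normalizedUnits]
    change groupAugmentation F G (1 + e * x) = 1
    rw [map_add, map_one, map_mul, he, groupAugmentation_powerSum, zero_mul, add_zero]

/-! ### Iterated commutators and the conjugation operator. -/

/-- Conjugation by a group element as a linear endomorphism of the group algebra. -/
noncomputable def MonoidAlgebra.conjLinear (F : Type*) {G : Type*} [Field F] [Group G] (h : G) :
    Module.End F (MonoidAlgebra F G) :=
  LinearMap.mulLeft F (MonoidAlgebra.of F G h) ∘ₗ LinearMap.mulRight F (MonoidAlgebra.of F G h⁻¹)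

theorem MonoidAlgebra.conjLinear_apply {F G : Type*} [Field F] [Group G] (h : G)
    (x : MonoidAlgebra F G) : MonoidAlgebra.conjLinear F h x =
      MonoidAlgebra.of F G h * x * MonoidAlgebra.of F G h⁻¹ := (mul_assoc _ _ _).symm

theorem MonoidAlgebra.conjLinear_pow_of {F G : Type*} [Field F] [Group G] (h a : G) (n : ℕ) :
    (MonoidAlgebra.conjLinear F h ^ n) (MonoidAlgebra.of F G a) =
      MonoidAlgebra.of F G (h ^ n * a * (h ^ n)⁻¹) := by
  induction n with
  | zero => simp
  | succ n ih =>
    rw [pow_succ', Module.End.mul_apply, ih, MonoidAlgebra.conjLinear_apply, ← map_mul, ← map_mul]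
    congr 1
    group

theorem MonoidAlgebra.commute_powerSum_conjLinear {F G : Type*} [Field F] [Group G] {p : ℕ}
    {z h : G} (hzh : Commute z h) {x : MonoidAlgebra F G}
    (hx : Commute (MonoidAlgebra.powerSum F p z) x) :
    Commute (MonoidAlgebra.powerSum F p z) (MonoidAlgebra.conjLinear F h x) := by
  rw [MonoidAlgebra.conjLinear_apply]
  exact ((MonoidAlgebra.commute_powerSum_of hzh).mul_right hx).mul_right
    (MonoidAlgebra.commute_powerSum_of hzh.inv_right)

theorem MonoidAlgebra.powerSum_mul_conjLinear {F G : Type*} [Field F] [Group G] {p : ℕ}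
    {z h : G} (hzh : Commute z h) (x : MonoidAlgebra F G) :
    MonoidAlgebra.powerSum F p z * MonoidAlgebra.conjLinear F h x =
      MonoidAlgebra.conjLinear F h (MonoidAlgebra.powerSum F p z * x) := by
  rw [MonoidAlgebra.conjLinear_apply, MonoidAlgebra.conjLinear_apply, ← mul_assoc, ← mul_assoc,
    ← mul_assoc, (MonoidAlgebra.commute_powerSum_of hzh).eq]

/-- Because `e² = 0`, `⁅h, 1 + e x⁆ = 1 + e (D x)` with `D = conj_h - 1`. Thus `1 + e (Dⁿ a)` lies
in the `n`-th lower central term of the group generated by `h` and `1 + e a`. -/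
theorem MonoidAlgebra.exists_powerSum_mul_conjLinear_sub_one_pow_eq_zero {F G : Type*} [Field F]
    [Group G] {p : ℕ} [CharP F p] (hV : IsLocallyNilpotentGroup (normalizedUnits F G))
    {z a h : G} (hz : z ^ p = 1) (hza : Commute z a) (hzh : Commute z h) :
    ∃ n, MonoidAlgebra.powerSum F p z *
      ((MonoidAlgebra.conjLinear F h - 1 : Module.End F (MonoidAlgebra F G)) ^ n)
        (MonoidAlgebra.of F G a) = 0 := by
  classical
  set e := MonoidAlgebra.powerSum F p z with he
  set D := MonoidAlgebra.conjLinear F h - 1 with hD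
  have hcomm : ∀ n, Commute e ((D ^ n) (MonoidAlgebra.of F G a)) := by
    intro n
    induction n with
    | zero => exact MonoidAlgebra.commute_powerSum_of hza
    | succ n ih =>
      rw [pow_succ', Module.End.mul_apply, hD, LinearMap.sub_apply, Module.End.one_apply]
      exact (MonoidAlgebra.commute_powerSum_conjLinear hzh ih).sub_right ih
  obtain ⟨u, hu, -⟩ := normalizedUnits.exists_eq_one_add_powerSum_mul hz (hcomm 0)
  set S : Subgroup (normalizedUnits F G) := Subgroup.closure {normalizedUnits.of F G h, u} with hS
  have hSfg : S.FG := ⟨{normalizedUnits.of F G h, u}, by simp [hS]⟩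
  obtain ⟨n, hn⟩ := (Subgroup.isNilpotent_iff_lowerCentralSeries S).1 (hV S hSfg)
  have key : ∀ n, ∀ v : normalizedUnits F G, ((v : (MonoidAlgebra F G)ˣ) : MonoidAlgebra F G) =
      1 + e * (D ^ n) (MonoidAlgebra.of F G a) → v ∈ S.lowerCentralSeries n := by
    intro n
    induction n with
    | zero =>
      intro v hv
      have : v = u := Subtype.ext (Units.ext (hv.trans hu.symm))
      rw [this]
      exact Subgroup.subset_closure (by simp)
    | succ n ih =>
      intro v hv
      obtain ⟨w, hw, hw'⟩ := normalizedUnits.exists_eq_one_add_powerSum_mul hz (hcomm n)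
      have hvw : v = ⁅normalizedUnits.of F G h, w⁆ := by
        refine Subtype.ext (Units.ext ?_)
        rw [hv, commutatorElement_def]
        simp only [Subgroup.coe_mul, Units.val_mul, Subgroup.coe_inv, normalizedUnits.coe_of,
          normalizedUnits.coe_of_inv, hw, hw']
        set x := (D ^ n) (MonoidAlgebra.of F G a) with hx
        have hconj : MonoidAlgebra.of F G h * (1 + e * x) * MonoidAlgebra.of F G h⁻¹ =
            1 + e * MonoidAlgebra.conjLinear F h x := by
          rw [MonoidAlgebra.powerSum_mul_conjLinear hzh, MonoidAlgebra.conjLinear_apply, mul_add,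
            add_mul, mul_one, ← map_mul, mul_inv_cancel, map_one]
        have hsq : e * MonoidAlgebra.conjLinear F h x * (e * x) = 0 := by
          rw [(MonoidAlgebra.commute_powerSum_conjLinear hzh (hcomm n)).eq, mul_assoc,
            ← mul_assoc e e, MonoidAlgebra.powerSum_mul_self hz, zero_mul, mul_zero]
        have hDx : (D ^ (n + 1)) (MonoidAlgebra.of F G a) = MonoidAlgebra.conjLinear F h x - x := by
          rw [pow_succ', Module.End.mul_apply, ← hx, hD, LinearMap.sub_apply, Module.End.one_apply]
        rw [← he, hconj, hDx, add_mul, mul_sub, mul_sub, mul_sub, hsq]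
        noncomm_ring
      rw [hvw, Subgroup.lowerCentralSeries_succ, Subgroup.commutator_comm]
      exact Subgroup.commutator_mem_commutator (Subgroup.subset_closure (by simp)) (ih w hw)
  obtain ⟨v, hv, -⟩ := normalizedUnits.exists_eq_one_add_powerSum_mul hz (hcomm n)
  have hv1 := key n v hv
  rw [hn, Subgroup.mem_bot] at hv1
  refine ⟨n, ?_⟩
  rw [hv1] at hv
  simpa using hv

theorem IsLocallyNilpotentGroup.exists_pow_commute {F G : Type*} [Field F] [Group G] {p : ℕ}
    [hp : Fact p.Prime] [CharP F p] (hV : IsLocallyNilpotentGroup (normalizedUnits F G))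
    {z a h : G} (hz : orderOf z = p) (hza : Commute z a) (hzh : Commute z h) :
    ∃ k : ℕ, Commute (h ^ p ^ k) a := by
  have hzp : z ^ p = 1 := hz ▸ pow_orderOf_eq_one z
  obtain ⟨n, hn⟩ := MonoidAlgebra.exists_powerSum_mul_conjLinear_sub_one_pow_eq_zero hV hzp hza hzh
  have hmono : ∀ m, MonoidAlgebra.powerSum F p z *
      ((MonoidAlgebra.conjLinear F h - 1) ^ (m + n)) (MonoidAlgebra.of F G a) = 0 := by
    intro m
    induction m with
    | zero => rwa [zero_add]
    | succ m ih =>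
      rw [Nat.succ_add, pow_succ', Module.End.mul_apply, LinearMap.sub_apply,
        Module.End.one_apply, mul_sub, MonoidAlgebra.powerSum_mul_conjLinear hzh, ih, map_zero,
        sub_zero]
  -- The exponent `n` is raised to `p ^ n` so that Frobenius applies to `conj_h - 1`.
  have hpn : p ^ n - n + n = p ^ n := Nat.sub_add_cancel (Nat.lt_pow_self hp.out.one_lt).le
  have h0 := hmono (p ^ n - n)
  have : CharP (Module.End F (MonoidAlgebra F G)) p :=
    charP_of_injective_algebraMap (RingHom.injective (algebraMap F _)) p
  rw [hpn, sub_pow_char_pow_of_commute p n (Commute.one_right _), one_pow, LinearMap.sub_apply,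
    Module.End.one_apply, MonoidAlgebra.conjLinear_pow_of, mul_sub, sub_eq_zero] at h0
  obtain ⟨i, hi⟩ := MonoidAlgebra.exists_eq_pow_mul_of_powerSum_mul_of_eq hp.out.pos hz h0
  set g := h ^ p ^ n with hg
  have hzg : Commute z g := hzh.pow_right _
  have h1 : a⁻¹ * g * a = z ^ i * g := by
    rw [mul_inv_eq_iff_eq_mul] at hi
    rw [mul_assoc, hi, ← mul_assoc, ← mul_assoc, ← (hza.pow_left i).inv_right.eq, mul_assoc (z ^ i),
      inv_mul_cancel, mul_one]
  -- Conjugation by `a` multiplies `g` by the factor `z ^ i`; one further `p`-th power removes it.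
  refine ⟨n + 1, ?_⟩
  have h2 : a⁻¹ * g ^ p * a = g ^ p := by
    have := congrArg (· ^ p) h1
    simp only [(hzg.pow_left i).mul_pow] at this
    rw [← pow_mul, mul_comm i, pow_mul, hzp, one_pow, one_mul] at this
    have hconj := conj_pow (a := a⁻¹) (b := g) (i := p)
    rw [inv_inv] at hconj
    exact hconj.symm.trans this
  rw [pow_succ, pow_mul, ← hg]
  rw [mul_assoc, inv_mul_eq_iff_eq_mul] at h2
  exact h2

/-! ### Necessity: the commutator subgroup is a `p`-group. -/

theorem isPGroup_quotient_center_of_exists_pow_commute {p : ℕ} (G : Type*) [Group G]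
    [hfg : Group.FG G] (h : ∀ a g : G, ∃ k : ℕ, Commute (g ^ p ^ k) a) :
    IsPGroup p (G ⧸ Subgroup.center G) := by
  intro x
  induction x using QuotientGroup.induction_on with
  | H g =>
    obtain ⟨s, hs⟩ := hfg.1
    choose k hk using h
    refine ⟨s.sup fun a => k a g, ?_⟩
    rw [← QuotientGroup.mk_pow, QuotientGroup.eq_one_iff, ← Subgroup.centralizer_univ,
      ← Subgroup.coe_top, ← hs, Subgroup.centralizer_closure, Subgroup.mem_centralizer_iff]
    intro a ha
    have hle : k a g ≤ s.sup fun a => k a g := Finset.le_sup (f := fun a => k a g) ha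
    obtain ⟨l, hl⟩ := Nat.exists_eq_add_of_le hle
    rw [hl, pow_add, pow_mul]
    exact ((hk a g).pow_left _).symm.eq

/-- Including a prescribed `g` lets the finitely generated subgroup keep an element of order `p`. -/
theorem Subgroup.exists_fg_mem_commutator {G : Type*} [Group G] (g : G) {x : G}
    (hx : x ∈ _root_.commutator G) : ∃ S : Subgroup G, S.FG ∧ g ∈ S ∧ x ∈ ⁅S, S⁆ := by
  classical
  have hpair : ∀ a b : G, ∃ S : Subgroup G, S.FG ∧ a ∈ S ∧ b ∈ S := fun a b =>
    ⟨Subgroup.closure {a, b}, ⟨{a, b}, by simp⟩, Subgroup.subset_closure (by simp),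
      Subgroup.subset_closure (by simp)⟩
  rw [commutator_eq_closure] at hx
  induction hx using Subgroup.closure_induction with
  | mem x hx =>
    obtain ⟨a, b, rfl⟩ := hx
    obtain ⟨S, hS, ha, hb⟩ := hpair a b
    obtain ⟨T, hT, hg, -⟩ := hpair g g
    exact ⟨S ⊔ T, hS.sup hT, le_sup_right (a := S) hg, Subgroup.commutator_mem_commutator
      (le_sup_left (b := T) ha) (le_sup_left (b := T) hb)⟩
  | one =>
    obtain ⟨T, hT, hg, -⟩ := hpair g g
    exact ⟨T, hT, hg, one_mem _⟩
  | mul x y _ _ hx hy =>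
    obtain ⟨S, hS, hgS, hx⟩ := hx
    obtain ⟨T, hT, -, hy⟩ := hy
    exact ⟨S ⊔ T, hS.sup hT, le_sup_left (b := T) hgS, mul_mem
      (Subgroup.commutator_mono le_sup_left le_sup_left hx)
      (Subgroup.commutator_mono le_sup_right le_sup_right hy)⟩
  | inv x _ hx =>
    obtain ⟨S, hS, hgS, hx⟩ := hx
    exact ⟨S, hS, hgS, inv_mem hx⟩

theorem Subgroup.map_subtype_commutator_eq {G : Type*} [Group G] (S : Subgroup G) :
    (_root_.commutator S).map S.subtype = ⁅S, S⁆ := by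
  rw [_root_.commutator_def, Subgroup.map_commutator, ← MonoidHom.range_eq_map, Subgroup.range_subtype]

theorem IsLocallyNilpotentGroup.isPGroup_commutator {F G : Type*} [Field F] [Group G] {p : ℕ}
    [hp : Fact p.Prime] [CharP F p] (hV : IsLocallyNilpotentGroup (normalizedUnits F G))
    {g : G} (hg : orderOf g = p) : IsPGroup p (commutator G) := by
  rintro ⟨x, hx⟩
  obtain ⟨S, hS, hgS, hxS⟩ := Subgroup.exists_fg_mem_commutator g hx
  have hSn : Group.IsNilpotent S := hV.of_injective _ (normalizedUnits.of_injective F G) S hS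
  have hSfg : Group.FG S := (Group.fg_iff_subgroup_fg S).2 hS
  obtain ⟨z, hzc, hz⟩ := Group.IsNilpotent.exists_center_orderOf_eq (⟨g, hgS⟩ : S)
    ((Subgroup.orderOf_mk g hgS).trans hg)
  have hcomm : ∀ y : S, Commute (z : G) y := fun y =>
    (congrArg Subtype.val (Subgroup.mem_center_iff.1 hzc y)).symm
  have hq : IsPGroup p (S ⧸ Subgroup.center S) := by
    refine isPGroup_quotient_center_of_exists_pow_commute S fun a h => ?_
    obtain ⟨k, hk⟩ := hV.exists_pow_commute (z := (z : G)) (a := a) (h := h)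
      ((Subgroup.orderOf_coe z).trans hz) (hcomm a) (hcomm h)
    exact ⟨k, Subtype.ext hk⟩
  rw [← Subgroup.map_subtype_commutator_eq] at hxS
  obtain ⟨y, hy, rfl⟩ := hxS
  obtain ⟨k, hk⟩ := Group.IsNilpotent.isPGroup_commutator_of_quotient_center S hq ⟨y, hy⟩
  exact ⟨k, Subtype.ext (congrArg (fun t : commutator S => ((t : S) : G)) hk)⟩

/-! ### Sufficiency: reduction to a finitely generated subgroup. -/

theorem MonoidAlgebra.mem_range_mapDomainRingHom_subtype {F G : Type*} [Field F] [Group G]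
    {H : Subgroup G} {x : MonoidAlgebra F G} (hx : (x.coeff.support : Set G) ⊆ H) :
    ∃ y, MonoidAlgebra.mapDomainRingHom F H.subtype y = x := by
  refine ⟨_, MonoidAlgebra.mapDomain_comapDomain (f := H.subtype) (by simpa using hx)
    Subtype.val_injective⟩

theorem isLocallyNilpotentGroup_normalizedUnits {F G : Type*} [Field F] [Group G] {p : ℕ}
    [hp : Fact p.Prime] [CharP F p] (hG : IsLocallyNilpotentGroup G)
    (hG' : IsPGroup p (commutator G)) : IsLocallyNilpotentGroup (normalizedUnits F G) := by
  classical
  rintro K ⟨s, rfl⟩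
  -- The supports of the inverses are included so that each generator comes from a unit of `FH`, not
  -- merely from an element.
  set t : Finset G := s.biUnion fun u =>
    ((u : (MonoidAlgebra F G)ˣ) : MonoidAlgebra F G).coeff.support ∪
    (((u : (MonoidAlgebra F G)ˣ)⁻¹ : (MonoidAlgebra F G)ˣ) : MonoidAlgebra F G).coeff.support
    with ht
  set H := Subgroup.closure (t : Set G) with hH
  have hHfg : Group.FG H := Group.closure_finset_fg t
  have hHn : Group.IsNilpotent H := hG H ⟨t, rfl⟩
  have hHp : IsPGroup p (commutator H) := by
    rintro ⟨x, hx⟩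
    have hx' : (x : G) ∈ commutator G := by
      have : (x : G) ∈ ⁅H, H⁆ := Subgroup.map_subtype_commutator_eq H ▸ ⟨x, hx, rfl⟩
      exact Subgroup.commutator_mono le_top le_top this
    obtain ⟨k, hk⟩ := hG' ⟨x, hx'⟩
    exact ⟨k, Subtype.ext (Subtype.ext (congrArg (fun y : commutator G => (y : G)) hk))⟩
  have hfin : Finite (commutator H) :=
    Group.IsNilpotent.finite_commutator_of_isOfFinOrder H fun x hx => by
      obtain ⟨k, hk⟩ := hHp ⟨x, hx⟩
      exact isOfFinOrder_iff_pow_eq_one.2 ⟨p ^ k, pow_pos hp.out.pos k, congrArg Subtype.val hk⟩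
  obtain ⟨n, hn⟩ := MonoidAlgebra.exists_strongLieSeries_eq_bot F H hHp
  have hU := Units.isNilpotent_of_strongLieSeries_eq_bot hn
  set φ := MonoidAlgebra.mapDomainRingHom F H.subtype with hφ
  have hφi : Function.Injective φ := MonoidAlgebra.mapDomain_injective Subtype.val_injective
  set Φ := Units.map (φ : MonoidAlgebra F H →* MonoidAlgebra F G) with hΦ
  have hrange : Group.IsNilpotent Φ.range :=
    Group.nilpotent_of_surjective Φ.rangeRestrict Φ.rangeRestrict_surjective
  have hle : Subgroup.closure (s : Set (normalizedUnits F G)) ≤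
      Φ.range.comap (normalizedUnits F G).subtype := by
    refine (Subgroup.closure_le _).2 fun u hu => ?_
    have hsub : (t : Set G) ⊆ H := Subgroup.subset_closure
    obtain ⟨a, ha⟩ := MonoidAlgebra.mem_range_mapDomainRingHom_subtype (H := H)
      (x := ((u : (MonoidAlgebra F G)ˣ) : MonoidAlgebra F G)) fun g hg => hsub
        (Finset.mem_biUnion.2 ⟨u, hu, Finset.mem_union_left _ hg⟩)
    obtain ⟨b, hb⟩ := MonoidAlgebra.mem_range_mapDomainRingHom_subtype (H := H)
      (x := (((u : (MonoidAlgebra F G)ˣ)⁻¹ : (MonoidAlgebra F G)ˣ) : MonoidAlgebra F G))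
        fun g hg => hsub (Finset.mem_biUnion.2 ⟨u, hu, Finset.mem_union_right _ hg⟩)
    refine ⟨⟨a, b, hφi ?_, hφi ?_⟩, Units.ext ha⟩
    · rw [map_mul, map_one, hφ, ha, hb, Units.mul_inv]
    · rw [map_mul, map_one, hφ, ha, hb, Units.inv_mul]
  set ι : Subgroup.closure (s : Set (normalizedUnits F G)) →* Φ.range :=
    ((normalizedUnits F G).subtype.comp (Subgroup.subtype _)).codRestrict Φ.range
      fun u => hle u.2 with hι
  have hιi : Function.Injective ι := fun u v huv => by
    have := congrArg Subtype.val huv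
    exact Subtype.ext (Subtype.ext this)
  have : Group.IsNilpotent ι.range := inferInstance
  exact Group.nilpotent_of_mulEquiv (MonoidHom.ofInjective hιi).symm

theorem theorem3 {F G : Type*} [Field F] [Group G] (p : ℕ) (hp : 0 < p) [CharP F p]
    (hmod : IsModularGroupAlgebra F G) :
    IsLocallyNilpotentGroup (normalizedUnits F G) ↔
      IsLocallyNilpotentGroup G ∧ IsPGroup p (commutator G) := by
  have hprime : Fact p.Prime := ⟨(CharP.char_is_prime_or_zero F p).resolve_right hp.ne'⟩
  obtain ⟨-, g, hg⟩ := hmod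
  rw [ringChar.eq F p] at hg
  exact ⟨fun hV => ⟨hV.of_injective _ (normalizedUnits.of_injective F G),
    hV.isPGroup_commutator hg⟩, fun h => isLocallyNilpotentGroup_normalizedUnits h.1 h.2⟩
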